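/- Let $M\in\mathbb{R}^{m\times n}$ have columns (atoms) $m_{(1)},\dots,m_{(n)}$ of unit Euclidean norm, let $1\le k<n$, and suppose that $M$ satisfies the restricted isometry property of order $2k$ with constant $\delta<1$, i.e. $(1-\delta)\|z\|^2\le\|Mz\|^2\le(1+\delta)\|z\|^2$ for every $z\in\mathbb{R}^n$ with at most $2k$ nonzero entries, where $(1-\delta)(1-\delta^2)-\delta>0$ (for instance $0\le\delta\le 0.445$). Let $x\in\mathbb{R}^n$ have exactly $k$ nonzero entries, and let $y=Mx+w$, where $w$ has independent $\mathcal N(0,\sigma^2)$ coordinates, $\sigma\ge 0$. Let $a\ge 0$. For a set $T$ of column indices let $M_T$ consist of the columns of $M$ in $T$, and put $B_T=(M_T^{\top}M_T)^{-1}$, $\hat x_T=B_TM_T^{\top}y$ (extended by $0$ off $T$) and $R_T=I-M_TB_TM_T^{\top}$. For $i\notin T$ let $g_T(i)=\langle R_Tm_{(i)},y\rangle^2/\|R_Tm_{(i)}\|^2$, and for $j\in T$ let $r_T(j)=\hat x_T(j)^2/B_T(j,j)$ be the contribution of $j$ to $T$. Ties in an argmax or argmin are broken arbitrarily, except where stated.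 OLSR: start with $T=\emptyset$ and, while $|T|<k+1$ and $R_Ty\ne0$, add some $i\in\arg\max_{i\notin T}g_T(i)$. If this ends with $R_Ty=0$ and $|T|\le k$, return $T$. Otherwise repeat: choose $j\in\arg\min_{j\in T}r_T(j)$, put $T'=T\setminus\{j\}$, and choose $i\in\arg\max_{i\notin T'}g_{T'}(i)$; if $g_{T'}(i)\le r_T(j)$ return $T'$, otherwise replace $T$ by $T'\cup\{i\}$. IOLSR (with support-size stopping rule): start with $T=\emptyset$ and repeat: choose $i\in\arg\max_{i\notin T}g_T(i)$ and put $T^+=T\cup\{i\}$. If $i$ does not minimize $r_{T^+}$ over $T^+$, choose $j\in\arg\min_{j\in T^+}r_{T^+}(j)$ and replace $T$ by $T^+\setminus\{j\}$. If $i$ does minimize $r_{T^+}$, then replace $T$ by $T^+$ if $|T^+|<k+1$, and return $T^+\setminus\{i\}$ if $|T^+|=k+1$. Both algorithms halt after finitely many steps on every input $y\in\mathbb{R}^m$. With probability exceeding $$1-\left(\sqrt{\pi(1+a)\log n}\;n^{a}\right)^{-1},$$ every support $T$ returned by OLSR or by IOLSR on $y=Mx+w$ yields an estimate $\hat x=\hat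 x_T$ with $$\|x-\hat x\|\le c_2\sqrt{2k\sigma^2(1+a)\log n},\qquad c_2=\frac{(1+\delta^2)\bigl(1+\sqrt{1-\delta}\bigr)}{(1-\delta)(1-\delta^2)-\delta}+\frac1{1-\delta}.$$ -/

import Mathlib

open MeasureTheory ProbabilityTheory
open scoped Matrix NNReal

noncomputable section

namespace LeastResidual

/-- The Euclidean norm of a real vector given by its coordinates. -/
def l2norm {ι : Type*} [Fintype ι] (v : ι → ℝ) : ℝ :=
  ‖(WithLp.toLp 2 v : EuclideanSpace ℝ ι)‖

/-- `M` satisfies the restricted isometry property of order `s` with constant `δ`.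
Here `hammingNorm z` is the number of nonzero entries of `z`. -/
def RIP {m n : ℕ} (M : Matrix (Fin m) (Fin n) ℝ) (s : ℕ) (δ : ℝ) : Prop :=
  ∀ z : Fin n → ℝ, hammingNorm z ≤ s →
    (1 - δ) * l2norm z ^ 2 ≤ l2norm (M *ᵥ z) ^ 2 ∧
      l2norm (M *ᵥ z) ^ 2 ≤ (1 + δ) * l2norm z ^ 2

section LeastSquares

variable {m n : ℕ} (M : Matrix (Fin m) (Fin n) ℝ) (y : Fin m → ℝ) (T : Finset (Fin n))

/-- The submatrix `A = M_T` of the columns of `M` indexed by `T`. -/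
def cols : Matrix (Fin m) T ℝ :=
  M.submatrix id Subtype.val

/-- `B = (Aᵀ A)⁻¹` for `A = M_T`. -/
def gramInv : Matrix T T ℝ :=
  ((cols M T)ᵀ * cols M T)⁻¹

/-- The least squares coefficients `(Aᵀ A)⁻¹ Aᵀ y` for `A = M_T`. -/
def lsCoeff : T → ℝ :=
  gramInv M T *ᵥ ((cols M T)ᵀ *ᵥ y)

/-- The least squares estimate with support `T`, as a vector in `ℝⁿ` that vanishes off `T`. -/
def estimate : Fin n → ℝ := fun i =>
  if h : i ∈ T then lsCoeff M y T ⟨i, h⟩ else 0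

/-- `R_T = I - A (Aᵀ A)⁻¹ Aᵀ` for `A = M_T`, the projection onto the orthogonal complement of
the column space of `M_T`. -/
def resProj : Matrix (Fin m) (Fin m) ℝ :=
  1 - cols M T * gramInv M T * (cols M T)ᵀ

/-- `c(i)² / ρ(i)` with `c(i) = ⟨R_T m_i, y⟩` and `ρ(i) = ‖R_T m_i‖²`: the decrease of the
squared residual when the atom `i ∉ T` joins the support `T`. -/
def gain (i : Fin n) : ℝ :=
  ((resProj M T *ᵥ M.col i) ⬝ᵥ y) ^ 2 / l2norm (resProj M T *ᵥ M.col i) ^ 2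

/-- `x̂(j)² / B(j,j)`: the contribution of the atom `j ∈ T` to the support `T`. -/
def contribution (j : T) : ℝ :=
  lsCoeff M y T j ^ 2 / gramInv M T j j

/-- `i ∈ argmax_{i ∉ T} c(i)² / ρ(i)`. -/
def IsBestAtom (i : Fin n) : Prop :=
  i ∉ T ∧ ∀ i' : Fin n, i' ∉ T → gain M y T i' ≤ gain M y T i

/-- `j ∈ argmin_{j ∈ T} x̂(j)² / B(j,j)`. -/
def IsLeastAtom (j : T) : Prop :=
  ∀ j' : T, contribution M y T j ≤ contribution M y T j'

end LeastSquares

/-- States of OLSR: building the initial support by OLS, replacing atoms, finished. -/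
inductive OLSRState (n : ℕ) : Type
  | init (T : Finset (Fin n)) : OLSRState n
  | loop (T : Finset (Fin n)) : OLSRState n
  | done (T : Finset (Fin n)) : OLSRState n

/-- One step of OLSR with target cardinality `k`. Ties in an argmax or argmin may be broken in
any way. -/
inductive OLSRStep {m n : ℕ} (M : Matrix (Fin m) (Fin n) ℝ) (y : Fin m → ℝ) (k : ℕ) :
    OLSRState n → OLSRState n → Prop
  /-- OLS step: the support has fewer than `k + 1` atoms and the residual is nonzero. -/
  | add (T : Finset (Fin n)) (i : Fin n) (hcard : T.card < k + 1)
      (hres : resProj M T *ᵥ y ≠ 0) (hi : IsBestAtom M y T i) :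
      OLSRStep M y k (.init T) (.init (insert i T))
  /-- Zero residual with at most `k` atoms: return at once. -/
  | early (T : Finset (Fin n)) (hcard : T.card ≤ k) (hres : resProj M T *ᵥ y = 0) :
      OLSRStep M y k (.init T) (.done T)
  /-- The initial support has `k + 1` atoms: enter the replacement loop. -/
  | enter (T : Finset (Fin n)) (hcard : T.card = k + 1) :
      OLSRStep M y k (.init T) (.loop T)
  /-- Remove the least contributing atom `j`, then insert the best atom `i`, if this lowers
  the residual. -/
  | replace (T : Finset (Fin n)) (j : T) (i : Fin n) (hj : IsLeastAtom M y T j)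
      (hi : IsBestAtom M y (T.erase j) i)
      (hlt : contribution M y T j < gain M y (T.erase j) i) :
      OLSRStep M y k (.loop T) (.loop (insert i (T.erase j)))
  /-- Remove the least contributing atom `j` and return, if no atom lowers the residual. -/
  | quit (T : Finset (Fin n)) (j : T) (i : Fin n) (hj : IsLeastAtom M y T j)
      (hi : IsBestAtom M y (T.erase j) i)
      (hle : gain M y (T.erase j) i ≤ contribution M y T j) :
      OLSRStep M y k (.loop T) (.done (T.erase j))

/-- States of IOLSR: iterating, finished. -/
inductive IOLSRState (n : ℕ) : Type
  | loop (T : Finset (Fin n)) : IOLSRState n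
  | done (T : Finset (Fin n)) : IOLSRState n

/-- One iteration of IOLSR with target cardinality `k`. The best atom `i` joins the support; if
another atom then contributes strictly less than `i`, a least contributing atom is removed;
otherwise the support has grown by one. As soon as it has `k + 1` atoms the iteration ends, and
the least contributing atom found last (which is `i`) is removed. Other ties may be broken in any
way. -/
inductive IOLSRStep {m n : ℕ} (M : Matrix (Fin m) (Fin n) ℝ) (y : Fin m → ℝ) (k : ℕ) :
    IOLSRState n → IOLSRState n → Prop
  | replace (T : Finset (Fin n)) (i : Fin n) (j : (insert i T : Finset (Fin n)))
      (hcard : T.card < k + 1) (hi : IsBestAtom M y T i)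
      (hj : IsLeastAtom M y (insert i T) j)
      (hne : ¬ IsLeastAtom M y (insert i T) ⟨i, Finset.mem_insert_self i T⟩) :
      IOLSRStep M y k (.loop T) (.loop ((insert i T).erase j))
  | grow (T : Finset (Fin n)) (i : Fin n) (hi : IsBestAtom M y T i)
      (hleast : IsLeastAtom M y (insert i T) ⟨i, Finset.mem_insert_self i T⟩)
      (hcard : (insert i T).card < k + 1) :
      IOLSRStep M y k (.loop T) (.loop (insert i T))
  | finish (T : Finset (Fin n)) (i : Fin n) (hi : IsBestAtom M y T i)
      (hleast : IsLeastAtom M y (insert i T) ⟨i, Finset.mem_insert_self i T⟩)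
      (hcard : (insert i T).card = k + 1) :
      IOLSRStep M y k (.loop T) (.done ((insert i T).erase i))

/-- Every run from `s₀` is finite and can only end in a state that satisfies `final`. -/
def AlwaysHalts {S : Type} (step : S → S → Prop) (final : S → Prop) (s₀ : S) : Prop :=
  Acc (fun s' s => step s s') s₀ ∧
    ∀ s, Relation.ReflTransGen step s₀ s → final s ∨ ∃ s', step s s'

/-- OLSR, run on `M`, `y`, `k`, always halts and returns a support. -/
def OLSRHalts {m n : ℕ} (M : Matrix (Fin m) (Fin n) ℝ) (y : Fin m → ℝ) (k : ℕ) : Prop :=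
  AlwaysHalts (OLSRStep M y k) (fun s => ∃ T, s = .done T) (.init ∅)

/-- IOLSR, run on `M`, `y`, `k`, always halts and returns a support. -/
def IOLSRHalts {m n : ℕ} (M : Matrix (Fin m) (Fin n) ℝ) (y : Fin m → ℝ) (k : ℕ) : Prop :=
  AlwaysHalts (IOLSRStep M y k) (fun s => ∃ T, s = .done T) (.loop ∅)

/-- `T` is a support that OLSR can return on `M`, `y`, `k`. -/
def OLSRReturns {m n : ℕ} (M : Matrix (Fin m) (Fin n) ℝ) (y : Fin m → ℝ) (k : ℕ)
    (T : Finset (Fin n)) : Prop :=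
  Relation.ReflTransGen (OLSRStep M y k) (.init ∅) (.done T)

/-- `T` is a support that IOLSR can return on `M`, `y`, `k`. -/
def IOLSRReturns {m n : ℕ} (M : Matrix (Fin m) (Fin n) ℝ) (y : Fin m → ℝ) (k : ℕ)
    (T : Finset (Fin n)) : Prop :=
  Relation.ReflTransGen (IOLSRStep M y k) (.loop ∅) (.done T)

/-- The constant `c₂` of the worst-case error bound. -/
def c₂ (δ : ℝ) : ℝ :=
  (1 + δ ^ 2) * (1 + √(1 - δ)) / ((1 - δ) * (1 - δ ^ 2) - δ) + 1 / (1 - δ)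

end LeastResidual

end

noncomputable section

namespace LeastResidual

/-! Every returned support `T` is of one of two kinds (`IsOutput`): its residual vanishes, or `T = V
\ {j}` where `j` contributes least to a set `V` of `k + 1` atoms and no atom outside `T` has gain
above that contribution `G`. In the second case each missed atom has squared correlation with the
residual at most its gain, hence at most `G`, while every coefficient of the estimate on `T` has
size at least `√G / κ` (`RIP.contribution_le_estimate_sq`). With `S` the support of `x`, `|S \ T| =
|T \ S|`, so the missed correlations are bounded in ℓ² by `κ` times the error on `T`
(`IsOutput.sum_sq_le`).

This forces stability (`RIP.estimate_error_le`). Let `q` be the error and `a = Mᵀ R_T y = MᵀM q + Mᵀ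
w`, which vanishes on `T`. On `S ∪ T`, RIP puts `a` within `δ‖q‖ + √(2k) τ` of `q` when all noise
correlations are at most `τ`. But `a` vanishing on `T` and being small off `T` gives `‖a - q‖ ≥
r‖q‖` with `κ = (1 - r²) / r`, whence `(r - δ)‖q‖ ≤ √(2k) τ`. The choice `r = 0.61 - 0.34 δ` is
admissible and gives `√2 / (r - δ) ≤ c₂`.

Halting follows from a lexicographic rank built on the captured energy. The probability comes from a
strict Mills bound and a union bound over the `n` atoms, with `τ = σ √(2 (1 + a) log n)`. -/

lemma l2norm_sq {ι : Type*} [Fintype ι] (v : ι → ℝ) : l2norm v ^ 2 = v ⬝ᵥ v := by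
  rw [l2norm, EuclideanSpace.norm_sq_eq, dotProduct]
  exact Finset.sum_congr rfl fun i _ => by simp [sq]

lemma l2norm_nonneg {ι : Type*} [Fintype ι] (v : ι → ℝ) : 0 ≤ l2norm v := norm_nonneg _

lemma dotProduct_self_nonneg {ι : Type*} [Fintype ι] (v : ι → ℝ) : 0 ≤ v ⬝ᵥ v :=
  l2norm_sq v ▸ sq_nonneg _

/-! ### Least squares on a support: dual vectors, and the effect of adding or removing one atom. -/

section Columns

variable {m n : ℕ} (M : Matrix (Fin m) (Fin n) ℝ) (y : Fin m → ℝ) (T V : Finset (Fin n))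

/-- `v` vanishes off `T`. -/
def SuppOn (v : Fin n → ℝ) : Prop := ∀ i ∉ T, v i = 0

/-- The columns of `M` indexed by `T` are linearly independent. -/
def Indep : Prop := ∀ v : Fin n → ℝ, SuppOn T v → M *ᵥ v = 0 → v = 0

/-- Extension by zero of a vector indexed by `T`. -/
def extend (c : T → ℝ) : Fin n → ℝ := fun i => if h : i ∈ T then c ⟨i, h⟩ else 0

variable {M y T V}

lemma suppOn_extend (c : T → ℝ) : SuppOn T (extend T c) := fun i hi => by simp [extend, hi]

@[simp] lemma extend_coe (c : T → ℝ) (t : T) : extend T c t = c t := by simp [extend]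

lemma SuppOn.mono {v : Fin n → ℝ} (h : SuppOn T v) (hTV : T ⊆ V) : SuppOn V v :=
  fun i hi => h i fun h' => hi (hTV h')

lemma SuppOn.dotProduct_eq {v : Fin n → ℝ} (h : SuppOn T v) (u : Fin n → ℝ) :
    v ⬝ᵥ u = ∑ i ∈ T, v i * u i := by
  rw [dotProduct]
  exact (Finset.sum_subset (Finset.subset_univ T) fun i _ hi => by simp [h i hi]).symm

lemma SuppOn.hammingNorm_le {v : Fin n → ℝ} (h : SuppOn T v) : hammingNorm v ≤ T.card := by
  refine Finset.card_le_card fun i hi => ?_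
  by_contra h'
  exact (Finset.mem_filter.1 hi).2 (h i h')

lemma Indep.mono (h : Indep M V) (hTV : T ⊆ V) : Indep M T :=
  fun v hv => h v (hv.mono hTV)

lemma mulVec_extend (c : T → ℝ) : M *ᵥ extend T c = cols M T *ᵥ c := by
  ext a
  simp only [Matrix.mulVec, dotProduct, cols, Matrix.submatrix_apply, id]
  rw [← Finset.sum_subset (Finset.subset_univ T), ← Finset.sum_coe_sort T]
  · simp
  · intro i _ hi
    simp [suppOn_extend c i hi]

lemma transpose_cols_mulVec (u : Fin m → ℝ) (t : T) :
    ((cols M T)ᵀ *ᵥ u) t = (Mᵀ *ᵥ u) t := rfl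

lemma transpose_mulVec_apply (u : Fin m → ℝ) (i : Fin n) : (Mᵀ *ᵥ u) i = M.col i ⬝ᵥ u := rfl

lemma mulVec_dotProduct (v : Fin n → ℝ) (u : Fin m → ℝ) :
    (M *ᵥ v) ⬝ᵥ u = v ⬝ᵥ (Mᵀ *ᵥ u) := by
  rw [dotProduct_comm, Matrix.dotProduct_mulVec, dotProduct_comm, Matrix.mulVec_transpose]

lemma Indep.isUnit_gram (h : Indep M T) : IsUnit ((cols M T)ᵀ * cols M T) := by
  have hinj : Function.Injective (cols M T).mulVec := by
    refine (injective_iff_map_eq_zero (cols M T).mulVecLin).2 fun c hc => ?_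
    have := h (extend T c) (suppOn_extend c) (by rw [mulVec_extend]; exact hc)
    ext t
    rw [← extend_coe c t, this]; rfl
  have := (Matrix.PosDef.conjTranspose_mul_self (cols M T) hinj).isUnit
  rwa [Matrix.conjTranspose_eq_transpose_of_trivial] at this

/-- The vector supported on `T` with `T`-coordinates `B_T c` solves the normal equations. -/
lemma Indep.gram_extend (h : Indep M T) (c : T → ℝ) (t : T) :
    (Mᵀ *ᵥ (M *ᵥ extend T (gramInv M T *ᵥ c))) t = c t := by
  rw [mulVec_extend, ← transpose_cols_mulVec, Matrix.mulVec_mulVec, Matrix.mulVec_mulVec,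
    gramInv, Matrix.mul_nonsing_inv _ ((Matrix.isUnit_iff_isUnit_det _).1 h.isUnit_gram),
    Matrix.one_mulVec]

lemma Indep.eq_of_gram_eq (h : Indep M T) {u v : Fin n → ℝ} (hu : SuppOn T u) (hv : SuppOn T v)
    (huv : ∀ t ∈ T, (Mᵀ *ᵥ (M *ᵥ u)) t = (Mᵀ *ᵥ (M *ᵥ v)) t) : u = v := by
  have hs : SuppOn T (u - v) := fun i hi => by simp [hu i hi, hv i hi]
  refine sub_eq_zero.1 (h _ hs ?_)
  rw [← dotProduct_self_eq_zero, mulVec_dotProduct, hs.dotProduct_eq]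
  refine Finset.sum_eq_zero fun t ht => ?_
  rw [Matrix.mulVec_sub, Matrix.mulVec_sub, Pi.sub_apply, Pi.sub_apply, huv t ht, sub_self, mul_zero]

lemma estimate_eq_extend : estimate M y T = extend T (lsCoeff M y T) := rfl

lemma suppOn_estimate : SuppOn T (estimate M y T) := suppOn_extend _

lemma Indep.gram_estimate (h : Indep M T) {t : Fin n} (ht : t ∈ T) :
    (Mᵀ *ᵥ (M *ᵥ estimate M y T)) t = (Mᵀ *ᵥ y) t :=
  h.gram_extend _ ⟨t, ht⟩

lemma resProj_mulVec (u : Fin m → ℝ) : resProj M T *ᵥ u = u - M *ᵥ estimate M u T := by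
  rw [resProj, Matrix.sub_mulVec, Matrix.one_mulVec, estimate_eq_extend, mulVec_extend, lsCoeff,
    Matrix.mulVec_mulVec, Matrix.mulVec_mulVec, Matrix.mul_assoc]

lemma Indep.estimate_unique (h : Indep M T) {v : Fin n → ℝ} (hv : SuppOn T v)
    (hvy : ∀ t ∈ T, (Mᵀ *ᵥ (M *ᵥ v)) t = (Mᵀ *ᵥ y) t) : estimate M y T = v :=
  h.eq_of_gram_eq suppOn_estimate hv fun t ht => by rw [h.gram_estimate ht, hvy t ht]

variable (M) in
/-- The `j`-th column of `B_T`, extended by zero. -/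
def dual (j : T) : Fin n → ℝ := extend T fun t => gramInv M T t j

lemma suppOn_dual (j : T) : SuppOn T (dual M j) := suppOn_extend _

lemma dual_coe (t j : T) : dual M j t = gramInv M T t j := extend_coe _ _

lemma Indep.gram_dual (h : Indep M T) (j : T) {t : Fin n} (ht : t ∈ T) :
    (Mᵀ *ᵥ (M *ᵥ dual M j)) t = if t = j then 1 else 0 := by
  have := h.gram_extend (Pi.single j 1) ⟨t, ht⟩
  rw [Matrix.mulVec_single_one] at this
  rw [show dual M j = extend T ((gramInv M T).col j) from rfl]
  simpa [Pi.single_apply, Subtype.ext_iff] using this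

/-- The images of the dual vectors are biorthogonal to the atoms of `T`, so pairing with one reads
off a coordinate. -/
lemma Indep.mulVec_dual_dotProduct (h : Indep M T) (j : T) {v : Fin n → ℝ} (hv : SuppOn T v) :
    (M *ᵥ v) ⬝ᵥ (M *ᵥ dual M j) = v j := by
  rw [mulVec_dotProduct, hv.dotProduct_eq, Finset.sum_eq_single (j : Fin n)]
  · simp [h.gram_dual j j.2]
  · intro t ht htj
    simp [h.gram_dual j ht, htj]
  · exact fun hj => absurd j.2 hj

lemma Indep.mulVec_dual_dotProduct_self (h : Indep M T) (j : T) :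
    (M *ᵥ dual M j) ⬝ᵥ (M *ᵥ dual M j) = gramInv M T j j := by
  rw [h.mulVec_dual_dotProduct j (suppOn_dual j), dual_coe]

lemma Indep.mulVec_dual_dotProduct_data (h : Indep M T) (j : T) :
    (M *ᵥ dual M j) ⬝ᵥ y = lsCoeff M y T j := by
  have h1 : (M *ᵥ dual M j) ⬝ᵥ y = (M *ᵥ dual M j) ⬝ᵥ (M *ᵥ estimate M y T) := by
    rw [mulVec_dotProduct, mulVec_dotProduct, (suppOn_dual j).dotProduct_eq,
      (suppOn_dual j).dotProduct_eq]
    exact Finset.sum_congr rfl fun t ht => by rw [h.gram_estimate ht]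
  rw [h1, dotProduct_comm, h.mulVec_dual_dotProduct j suppOn_estimate, estimate_eq_extend,
    extend_coe]

/-- Cauchy–Schwarz: the unit atom `m_j` has inner product 1 with a vector of squared norm `B(j,j)`.
-/
lemma Indep.one_le_gramInv (h : Indep M T) (hunit : ∀ j, l2norm (M.col j) = 1) (j : T) :
    1 ≤ gramInv M T j j := by
  have h1 : (M.col j) ⬝ᵥ (M *ᵥ dual M j) = 1 := by
    rw [← transpose_mulVec_apply, h.gram_dual j j.2, if_pos rfl]
  have h2 : 0 ≤ (M.col j - M *ᵥ dual M j) ⬝ᵥ (M.col j - M *ᵥ dual M j) :=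
    dotProduct_self_nonneg _
  rw [sub_dotProduct, dotProduct_sub, dotProduct_sub, ← l2norm_sq, hunit,
    h.mulVec_dual_dotProduct_self, dotProduct_comm (M *ᵥ _), h1] at h2
  linarith

/-- The multiple of the dual vector is the one that cancels coordinate `j`; the other normal
equations survive because its image is orthogonal to the other atoms. -/
lemma Indep.estimate_erase (h : Indep M V) (hunit : ∀ j, l2norm (M.col j) = 1) (j : V) :
    estimate M y (V.erase j) =
      estimate M y V - (lsCoeff M y V j / gramInv M V j j) • dual M j := by
  have hpos : 0 < gramInv M V j j := by linarith [h.one_le_gramInv hunit j]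
  refine (h.mono (Finset.erase_subset _ _)).estimate_unique (fun i hi => ?_) fun t ht => ?_
  · by_cases hij : i = j
    · subst hij
      simp only [Pi.sub_apply, Pi.smul_apply, smul_eq_mul, dual_coe, estimate_eq_extend, extend_coe]
      field_simp; ring
    · have hiV : i ∉ V := fun h' => hi (Finset.mem_erase.2 ⟨hij, h'⟩)
      simp [suppOn_estimate i hiV, suppOn_dual j i hiV]
  · obtain ⟨htj, htV⟩ := Finset.mem_erase.1 ht
    rw [Matrix.mulVec_sub, Matrix.mulVec_sub, Matrix.mulVec_smul, Matrix.mulVec_smul, Pi.sub_apply,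
      Pi.smul_apply, h.gram_dual j htV, if_neg htj, h.gram_estimate htV, smul_zero, sub_zero]

lemma Indep.resProj_erase_col (h : Indep M V) (hunit : ∀ j, l2norm (M.col j) = 1) (j : V) :
    resProj M (V.erase j) *ᵥ M.col j = (gramInv M V j j)⁻¹ • (M *ᵥ dual M j) := by
  have hpos : 0 < gramInv M V j j := by linarith [h.one_le_gramInv hunit j]
  -- The atom lies in the span of `V`, so its own least squares fit is a coordinate vector.
  have h1 : estimate M (M.col j) V = Pi.single (j : Fin n) 1 := by
    refine h.estimate_unique (fun i hi => ?_) fun t ht => by rw [Matrix.mulVec_single_one]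
    rw [Pi.single_eq_of_ne]
    rintro rfl
    exact hi j.2
  have h2 : lsCoeff M (M.col j) V j = 1 := by
    rw [← extend_coe (lsCoeff M (M.col j) V) j, ← estimate_eq_extend, h1, Pi.single_eq_same]
  rw [resProj_mulVec, h.estimate_erase hunit j, h1, h2, Matrix.mulVec_sub, Matrix.mulVec_single_one,
    Matrix.mulVec_smul, sub_sub_cancel, one_div]

/-- What `j` costs on leaving `V` is what it would gain on coming back. This identity links the two
selection rules of both algorithms. -/
lemma Indep.gain_erase (h : Indep M V) (hunit : ∀ j, l2norm (M.col j) = 1) (j : V) :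
    gain M y (V.erase j) j = contribution M y V j := by
  have hpos : 0 < gramInv M V j j := by linarith [h.one_le_gramInv hunit j]
  rw [gain, contribution, h.resProj_erase_col hunit, l2norm_sq, smul_dotProduct, smul_dotProduct,
    dotProduct_smul, h.mulVec_dual_dotProduct_data, h.mulVec_dual_dotProduct_self]
  simp only [smul_eq_mul]
  field_simp

variable (M y) in
/-- The squared norm of the projection of `y` onto the span of the columns in `T`. -/
def energy (T : Finset (Fin n)) : ℝ := (M *ᵥ estimate M y T) ⬝ᵥ y

lemma Indep.energy_erase (h : Indep M V) (hunit : ∀ j, l2norm (M.col j) = 1) (j : V) :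
    energy M y (V.erase j) = energy M y V - contribution M y V j := by
  rw [energy, h.estimate_erase hunit, Matrix.mulVec_sub, Matrix.mulVec_smul, sub_dotProduct,
    smul_dotProduct, h.mulVec_dual_dotProduct_data, energy, contribution, smul_eq_mul]
  ring

lemma Indep.contribution_nonneg (h : Indep M V) (hunit : ∀ j, l2norm (M.col j) = 1) (j : V) :
    0 ≤ contribution M y V j :=
  div_nonneg (sq_nonneg _) (by linarith [h.one_le_gramInv hunit j])

lemma Indep.gain_insert {i : Fin n} (h : Indep M (insert i T)) (hi : i ∉ T)
    (hunit : ∀ j, l2norm (M.col j) = 1) :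
    gain M y T i = contribution M y (insert i T) ⟨i, Finset.mem_insert_self i T⟩ := by
  rw [← h.gain_erase hunit, Finset.erase_insert hi]

lemma Indep.energy_insert {i : Fin n} (h : Indep M (insert i T)) (hi : i ∉ T)
    (hunit : ∀ j, l2norm (M.col j) = 1) :
    energy M y (insert i T) = energy M y T + gain M y T i := by
  have := h.energy_erase (y := y) hunit ⟨i, Finset.mem_insert_self i T⟩
  rw [← h.gain_erase hunit, Finset.erase_insert hi] at this
  linarith

/-- The inner product of an atom with the residual is controlled by its gain. -/
lemma Indep.sq_col_dotProduct_le {i : Fin n} (h : Indep M (insert i T)) (hi : i ∉ T)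
    (hunit : ∀ j, l2norm (M.col j) = 1) :
    (M.col i ⬝ᵥ (resProj M T *ᵥ y)) ^ 2 ≤ gain M y T i := by
  set V := insert i T with hV
  set j : V := ⟨i, Finset.mem_insert_self i T⟩ with hj
  have h1 := h.one_le_gramInv hunit j
  have hres : resProj M T *ᵥ y = y - M *ᵥ estimate M y V +
      (lsCoeff M y V j / gramInv M V j j) • M *ᵥ dual M j := by
    have := h.estimate_erase (y := y) hunit j
    rw [show V.erase j = T from Finset.erase_insert hi] at this
    rw [resProj_mulVec, this, Matrix.mulVec_sub, Matrix.mulVec_smul]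
    abel
  have h2 : M.col i ⬝ᵥ (resProj M T *ᵥ y) = lsCoeff M y V j / gramInv M V j j := by
    rw [hres, ← transpose_mulVec_apply, Matrix.mulVec_add, Matrix.mulVec_sub, Matrix.mulVec_smul,
      Pi.add_apply, Pi.sub_apply, Pi.smul_apply, h.gram_estimate j.2, h.gram_dual j j.2]
    simp [hj]
  -- With `z` the new coefficient and `b` the diagonal entry, the correlation is `z / b` and the
  -- gain `z² / b`; `b ≥ 1` compares them.
  rw [h2, h.gain_insert hi hunit, contribution, div_pow]
  exact div_le_div_of_nonneg_left (sq_nonneg _) (by linarith) (by nlinarith)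

/-- Schur complement: `B(t,t) - B(t,i)² / B(i,i)` is the diagonal entry at `t` of the inverse Gram
matrix of `V \ {i}`, and such entries are at least 1. The vector `u` below is the dual vector of `t`
in `V \ {i}`. -/
lemma Indep.gramInv_erase (h : Indep M V) (hunit : ∀ j, l2norm (M.col j) = 1) (i t : V)
    (hti : t ≠ i) : 1 + gramInv M V t i ^ 2 / gramInv M V i i ≤ gramInv M V t t := by
  have hi := h.one_le_gramInv hunit i
  set B := gramInv M V with hB
  set u := dual M t - (B t i / B i i) • dual M i with hu
  have h1 : M.col t ⬝ᵥ (M *ᵥ u) = 1 := by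
    rw [← transpose_mulVec_apply, hu, Matrix.mulVec_sub, Matrix.mulVec_smul, Matrix.mulVec_sub,
      Matrix.mulVec_smul, Pi.sub_apply, Pi.smul_apply, h.gram_dual t t.2, h.gram_dual i t.2, if_pos rfl,
      if_neg (fun h => hti (Subtype.ext h))]
    simp
  have hsymm : B i t = B t i := by
    have e1 := h.mulVec_dual_dotProduct i (suppOn_dual (M := M) t)
    have e2 := h.mulVec_dual_dotProduct t (suppOn_dual (M := M) i)
    rw [dual_coe] at e1 e2
    rw [hB, ← e1, ← e2, dotProduct_comm]
  have h2 : (M *ᵥ u) ⬝ᵥ (M *ᵥ u) = B t t - B t i ^ 2 / B i i := by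
    rw [hu, Matrix.mulVec_sub, Matrix.mulVec_smul, sub_dotProduct, dotProduct_sub, dotProduct_sub,
      smul_dotProduct, smul_dotProduct, dotProduct_smul, dotProduct_smul,
      h.mulVec_dual_dotProduct t (suppOn_dual _), h.mulVec_dual_dotProduct t (suppOn_dual _),
      h.mulVec_dual_dotProduct i (suppOn_dual _), h.mulVec_dual_dotProduct i (suppOn_dual _)]
    simp only [dual_coe, smul_eq_mul]
    rw [← hB, hsymm]
    field_simp
    ring
  have h3 : 0 ≤ (M.col t - M *ᵥ u) ⬝ᵥ (M.col t - M *ᵥ u) := dotProduct_self_nonneg _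
  rw [sub_dotProduct, dotProduct_sub, dotProduct_sub, ← l2norm_sq, hunit, h2,
    dotProduct_comm (M *ᵥ _), h1] at h3
  linarith

end Columns

/-! ### Consequences of RIP for Gram matrices, and the deterministic stability estimate. -/

section Stability

lemma sqrt_sum_add_sq_le {ι : Type*} (U : Finset ι) (f g : ι → ℝ) :
    √(∑ i ∈ U, (f i + g i) ^ 2) ≤ √(∑ i ∈ U, f i ^ 2) + √(∑ i ∈ U, g i ^ 2) := by
  have h := norm_add_le (WithLp.toLp 2 (fun i : U => f i) : EuclideanSpace ℝ U)
    (WithLp.toLp 2 (fun i : U => g i))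
  simp only [EuclideanSpace.norm_eq, PiLp.add_apply, Real.norm_eq_abs, sq_abs] at h
  rwa [Finset.sum_coe_sort U fun i => (f i + g i) ^ 2, Finset.sum_coe_sort U fun i => f i ^ 2,
    Finset.sum_coe_sort U fun i => g i ^ 2] at h

variable {m n : ℕ} {M : Matrix (Fin m) (Fin n) ℝ} {y : Fin m → ℝ} {T V : Finset (Fin n)} {s : ℕ}
  {δ : ℝ}

lemma RIP.dotProduct_le (h : RIP M s δ) {v : Fin n → ℝ} (hv : SuppOn V v) (hV : V.card ≤ s) :
    (1 - δ) * (v ⬝ᵥ v) ≤ (M *ᵥ v) ⬝ᵥ (M *ᵥ v) ∧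
      (M *ᵥ v) ⬝ᵥ (M *ᵥ v) ≤ (1 + δ) * (v ⬝ᵥ v) := by
  have := h v (hv.hammingNorm_le.trans hV)
  rwa [l2norm_sq, l2norm_sq] at this

lemma RIP.nonneg (h : RIP M s δ) (hs : 1 ≤ s) (hunit : ∀ j, l2norm (M.col j) = 1) (j : Fin n) :
    0 ≤ δ := by
  have hv : SuppOn {j} (Pi.single j (1 : ℝ)) := fun i hi => by
    rw [Pi.single_eq_of_ne (by simpa using hi)]
  have := (h.dotProduct_le hv (by simpa using hs)).2
  rw [Matrix.mulVec_single_one, ← l2norm_sq, hunit] at this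
  simp only [single_dotProduct, Pi.single_eq_same] at this
  linarith

lemma RIP.indep (h : RIP M s δ) (hδ : δ < 1) (hV : V.card ≤ s) : Indep M V := by
  intro v hv h0
  have h1 := (h.dotProduct_le hv hV).1
  rw [h0, dotProduct_zero] at h1
  have h2 := dotProduct_self_nonneg v
  exact dotProduct_self_eq_zero.1 (by nlinarith)

/-- On supports of admissible size, the Gram matrix is within `δ` of the identity. -/
lemma RIP.sum_gram_sub_sq_le (h : RIP M s δ) (hδ0 : 0 ≤ δ) {u : Fin n → ℝ} (hu : SuppOn V u)
    (hV : V.card ≤ s) :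
    ∑ i ∈ V, ((Mᵀ *ᵥ (M *ᵥ u)) i - u i) ^ 2 ≤ δ ^ 2 * (u ⬝ᵥ u) := by
  set r := Mᵀ *ᵥ (M *ᵥ u) with hr
  let v : Fin n → ℝ := fun i => if i ∈ V then r i - u i else 0
  have hv : SuppOn V v := fun i hi => by simp [v, hi]
  have hvv : v ⬝ᵥ v = ∑ i ∈ V, (r i - u i) ^ 2 := by
    rw [hv.dotProduct_eq]
    exact Finset.sum_congr rfl fun i hi => by simp [v, hi, sq]
  have hcross : (M *ᵥ v) ⬝ᵥ (M *ᵥ u) - v ⬝ᵥ u = v ⬝ᵥ v := by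
    rw [mulVec_dotProduct, hvv, hv.dotProduct_eq, hv.dotProduct_eq, ← Finset.sum_sub_distrib]
    exact Finset.sum_congr rfl fun i hi => by simp only [v, hi, if_true]; ring
  -- Polarization: the upper RIP bound at `u + c v` minus the lower one at `u - c v`.
  have key : ∀ c : ℝ, 2 * c * (v ⬝ᵥ v) ≤ δ * (u ⬝ᵥ u + c ^ 2 * (v ⬝ᵥ v)) := by
    intro c
    have h1 := (h.dotProduct_le (v := u + c • v)
      (fun i hi => by simp [hu i hi, hv i hi]) hV).2
    have h2 := (h.dotProduct_le (v := u - c • v)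
      (fun i hi => by simp [hu i hi, hv i hi]) hV).1
    simp only [Matrix.mulVec_add, Matrix.mulVec_sub, Matrix.mulVec_smul, add_dotProduct,
      sub_dotProduct, dotProduct_add, dotProduct_sub, smul_dotProduct, dotProduct_smul,
      smul_eq_mul, dotProduct_comm u v, dotProduct_comm (M *ᵥ u) (M *ᵥ v)] at h1 h2
    rw [← hcross]
    rw [← hcross] at h1 h2
    linarith
  rw [← hvv]
  rcases hδ0.eq_or_lt with h0 | h0
  · have := key 1
    rw [← h0] at this ⊢
    linarith
  -- This `c` balances the two sides: at the extremal `‖v‖ = δ‖u‖` the two terms on the right agree.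
  · have := key δ⁻¹
    have e : δ * (u ⬝ᵥ u + δ⁻¹ ^ 2 * (v ⬝ᵥ v)) = δ * (u ⬝ᵥ u) + δ⁻¹ * (v ⬝ᵥ v) := by
      field_simp
    rw [e] at this
    have h3 : δ⁻¹ * (v ⬝ᵥ v) ≤ δ * (u ⬝ᵥ u) := by linarith
    rw [inv_mul_le_iff₀ h0] at h3
    linarith

/-- The `i`-th column `β` of `B` is mapped by the Gram matrix to `e_i`, so near-identity of that
matrix gives `‖e_i - β‖² ≤ δ²‖β‖²`. This confines the pair of entries `(B(i,i), B(t,i))` to a disc,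
whose extent in the second direction is the stated bound. -/
lemma RIP.gramInv_offDiag_sq_le (h : RIP M s δ) (hδ0 : 0 ≤ δ) (hδ : δ < 1) (hV : V.card ≤ s)
    {i t : V} (hti : t ≠ i) :
    gramInv M V t i ^ 2 ≤ (δ / (1 - δ ^ 2)) ^ 2 := by
  have hV' := h.indep hδ hV
  have h1 := h.sum_gram_sub_sq_le hδ0 (suppOn_dual (M := M) i) hV
  set β := dual M i with hβ
  set b := gramInv M V i i with hb
  have hsum : ∑ l ∈ V, ((Mᵀ *ᵥ (M *ᵥ β)) l - β l) ^ 2 = 1 - 2 * b + β ⬝ᵥ β := by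
    have e : ∀ l ∈ V, ((Mᵀ *ᵥ (M *ᵥ β)) l - β l) ^ 2 =
        (if l = i then 1 - 2 * b else 0) + β l * β l := by
      intro l hl
      rw [hV'.gram_dual i hl]
      split_ifs with hli
      · rw [hli, hβ, dual_coe]; ring
      · ring
    rw [Finset.sum_congr rfl e, Finset.sum_add_distrib, ← (suppOn_dual (M := M) i).dotProduct_eq,
      Finset.sum_ite_eq' V (i : Fin n), if_pos i.2]
  have hbig : b ^ 2 + gramInv M V t i ^ 2 ≤ β ⬝ᵥ β := by
    rw [(suppOn_dual (M := M) i).dotProduct_eq]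
    have hne : (i : Fin n) ≠ t := fun h => hti (Subtype.ext h.symm)
    have := Finset.sum_le_sum_of_subset_of_nonneg (s := {(i : Fin n), (t : Fin n)}) (t := V)
      (f := fun l => β l * β l) (by
        intro l hl
        rcases Finset.mem_insert.1 hl with rfl | hl
        · exact i.2
        · rw [Finset.mem_singleton.1 hl]; exact t.2)
      fun _ _ _ => mul_self_nonneg _
    rw [Finset.sum_pair hne, hβ, dual_coe, dual_coe] at this
    rw [hb]
    nlinarith
  rw [hsum] at h1
  have hd : 0 < 1 - δ ^ 2 := by nlinarith
  set g := gramInv M V t i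
  rw [div_pow, le_div_iff₀ (by positivity)]
  have h2 : (1 - δ ^ 2) * (b ^ 2 + g ^ 2) ≤ 2 * b - 1 := by nlinarith
  -- Completing the square in `b`; the centre of the disc is at `b = 1 / (1 - δ²)`.
  nlinarith [sq_nonneg ((1 - δ ^ 2) * b - 1)]

/-- If the last atom `i` contributes least to `V`, every remaining atom keeps a coefficient
comparable with the gain of `i`. -/
lemma RIP.contribution_le_estimate_sq (h : RIP M s δ) (hδ0 : 0 ≤ δ) (hδ : δ < 1)
    (hunit : ∀ j, l2norm (M.col j) = 1) (hV : V.card ≤ s) {i : V} (hi : IsLeastAtom M y V i)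
    {κ : ℝ} (hκ : 0 < κ) (hκ' : 1 + 2 * (δ / (1 - δ ^ 2)) * κ ≤ κ ^ 2) {t : Fin n}
    (ht : t ∈ V.erase i) :
    contribution M y V i ≤ κ ^ 2 * estimate M y (V.erase i) t ^ 2 := by
  have hV' := h.indep hδ hV
  obtain ⟨hti, htV⟩ := Finset.mem_erase.1 ht
  have hti' : (⟨t, htV⟩ : V) ≠ i := fun h => hti (congrArg Subtype.val h)
  have hest : estimate M y (V.erase i) t = lsCoeff M y V ⟨t, htV⟩ -
      lsCoeff M y V i / gramInv M V i i * gramInv M V ⟨t, htV⟩ i := by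
    rw [hV'.estimate_erase hunit, estimate_eq_extend, Pi.sub_apply, Pi.smul_apply, smul_eq_mul,
      show dual M i t = _ from dual_coe ⟨t, htV⟩ i,
      show extend V _ t = _ from extend_coe (lsCoeff M y V) ⟨t, htV⟩]
  have hleast := hi ⟨t, htV⟩
  have hdiag := hV'.gramInv_erase hunit i ⟨t, htV⟩ hti'
  have hoff := h.gramInv_offDiag_sq_le hδ0 hδ hV hti'
  have hBi := hV'.one_le_gramInv hunit i
  have hBt := hV'.one_le_gramInv hunit ⟨t, htV⟩
  rw [hest]
  unfold contribution at hleast ⊢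
  generalize lsCoeff M y V ⟨t, htV⟩ = zt at *
  generalize lsCoeff M y V i = zi at *
  generalize gramInv M V ⟨t, htV⟩ i = g at *
  generalize gramInv M V ⟨t, htV⟩ ⟨t, htV⟩ = bt at *
  generalize gramInv M V i i = b at *
  have hb : 0 < b := by linarith
  have hu0 : 0 ≤ δ / (1 - δ ^ 2) := div_nonneg hδ0 (by nlinarith)
  generalize δ / (1 - δ ^ 2) = u at *
  -- Normalized quantities: `γ²` is the contribution of `i`, and removing `i` changes the
  -- coefficient at `t` by exactly `γ v` in absolute value.
  set γ := |zi| / √b with hγ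
  set v := |g| / √b with hv
  have hsb : 0 < √b := Real.sqrt_pos.2 hb
  have hγ0 : 0 ≤ γ := by positivity
  have hv0 : 0 ≤ v := by positivity
  have hγsq : γ ^ 2 = zi ^ 2 / b := by rw [hγ, div_pow, sq_abs, Real.sq_sqrt hb.le]
  have hvsq : v ^ 2 = g ^ 2 / b := by rw [hv, div_pow, sq_abs, Real.sq_sqrt hb.le]
  have hvu : v ≤ u := by
    refine abs_le_of_sq_le_sq' ?_ hu0 |>.2
    rw [hvsq]
    exact (div_le_self (sq_nonneg _) hBi).trans hoff
  have hprod : |zi / b * g| = γ * v := by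
    rw [abs_mul, abs_div, abs_of_pos hb, hγ, hv]
    rw [div_mul_div_comm, Real.mul_self_sqrt hb.le]
    ring
  have hzt : γ ^ 2 * (1 + v ^ 2) ≤ zt ^ 2 := by
    rw [← hγsq, le_div_iff₀ (by linarith)] at hleast
    rw [← hvsq] at hdiag
    nlinarith [mul_le_mul_of_nonneg_left hdiag (sq_nonneg γ)]
  -- The hypothesis on `κ` says `(1/κ + v)² ≤ 1 + v²` for all `v` up to `u`, so the coefficient at
  -- `t` keeps `γ / κ` after losing at most `γ v`.
  have hzt' : γ * (1 / κ + v) ≤ |zt| := by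
    refine abs_le_of_sq_le_sq' ?_ (abs_nonneg _) |>.2
    rw [sq_abs]
    refine le_trans ?_ hzt
    rw [mul_pow]
    refine mul_le_mul_of_nonneg_left ?_ (sq_nonneg γ)
    have : (1 / κ + v) ^ 2 = (1 + 2 * v * κ) / κ ^ 2 + v ^ 2 := by field_simp; ring
    rw [this]
    have : (1 + 2 * v * κ) / κ ^ 2 ≤ 1 := by
      rw [div_le_one (by positivity)]
      nlinarith
    linarith
  have habs : γ / κ ≤ |zt - zi / b * g| := by
    have := abs_sub_abs_le_abs_sub zt (zi / b * g)
    rw [hprod] at this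
    have e : γ * (1 / κ + v) = γ / κ + γ * v := by ring
    linarith
  rw [← hγsq, ← sq_abs (zt - _), ← mul_pow]
  refine pow_le_pow_left₀ hγ0 ?_ 2
  rwa [div_le_iff₀' hκ] at habs

/-- Stability: if the atoms missed by `T` correlate weakly with the residual, the least squares
estimate on `T` is close to the signal. -/
lemma RIP.estimate_error_le (h : RIP M s δ) (hδ0 : 0 ≤ δ) {x : Fin n → ℝ} {S : Finset (Fin n)}
    (hT : Indep M T) (hx : SuppOn S x) (hST : (S ∪ T).card ≤ s) {w : Fin m → ℝ} {τ : ℝ}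
    (hτ : 0 ≤ τ) (hw : ∀ i, |M.col i ⬝ᵥ w| ≤ τ) (hy : y = M *ᵥ x + w) {r κ : ℝ} (hr : 0 < r) (hr1 : r < 1)
    (hκ : κ * r = 1 - r ^ 2)
    (hsel : ∑ i ∈ S \ T, (M.col i ⬝ᵥ (resProj M T *ᵥ y)) ^ 2 ≤
      κ ^ 2 * ∑ t ∈ T, (x t - estimate M y T t) ^ 2) :
    (r - δ) * l2norm (x - estimate M y T) ≤ √(s : ℝ) * τ := by
  set q := x - estimate M y T with hq
  set U := S ∪ T with hU
  have hqU : SuppOn U q := fun i hi => by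
    have h1 : i ∉ S := fun h' => hi (Finset.mem_union_left _ h')
    have h2 : i ∉ T := fun h' => hi (Finset.mem_union_right _ h')
    simp [hq, hx i h1, suppOn_estimate i h2]
  have hκ0 : 0 < κ := by
    have : 0 < κ * r := by nlinarith
    exact pos_of_mul_pos_left this hr.le
  have hres : Mᵀ *ᵥ (M *ᵥ q) + Mᵀ *ᵥ w = Mᵀ *ᵥ (resProj M T *ᵥ y) := by
    rw [resProj_mulVec, hq, hy]
    simp only [Matrix.mulVec_sub, Matrix.mulVec_add]
    abel
  have hresT : ∀ t ∈ T, (Mᵀ *ᵥ (resProj M T *ᵥ y)) t = 0 := fun t ht => by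
    rw [resProj_mulVec, Matrix.mulVec_sub, Pi.sub_apply, hT.gram_estimate ht, sub_self]
  set a := Mᵀ *ᵥ (resProj M T *ᵥ y) with ha
  have hnoise : √(∑ i ∈ U, (Mᵀ *ᵥ w) i ^ 2) ≤ √(s : ℝ) * τ := by
    rw [← Real.sqrt_sq hτ, ← Real.sqrt_mul (Nat.cast_nonneg _)]
    refine Real.sqrt_le_sqrt ?_
    calc ∑ i ∈ U, (Mᵀ *ᵥ w) i ^ 2 ≤ ∑ _i ∈ U, τ ^ 2 := by
          refine Finset.sum_le_sum fun i _ => ?_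
          rw [← sq_abs]
          exact pow_le_pow_left₀ (abs_nonneg _) (hw i) 2
      _ = U.card * τ ^ 2 := by rw [Finset.sum_const, nsmul_eq_mul]
      _ ≤ s * τ ^ 2 := by gcongr
  have hgram : √(∑ i ∈ U, ((Mᵀ *ᵥ (M *ᵥ q)) i - q i) ^ 2) ≤ δ * l2norm q := by
    refine (Real.sqrt_le_sqrt (h.sum_gram_sub_sq_le hδ0 hqU hST)).trans_eq ?_
    rw [← l2norm_sq, ← mul_pow, Real.sqrt_sq (mul_nonneg hδ0 (l2norm_nonneg _))]
  have htri : √(∑ i ∈ U, (a i - q i) ^ 2) ≤ δ * l2norm q + √(s : ℝ) * τ := by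
    refine le_trans ?_ (add_le_add hgram hnoise)
    refine le_trans (le_of_eq ?_) (sqrt_sum_add_sq_le U _ _)
    congr 1
    refine Finset.sum_congr rfl fun i _ => ?_
    rw [← hres, Pi.add_apply]
    ring
  have hsplit : ∀ f : Fin n → ℝ, ∑ i ∈ U, f i = ∑ i ∈ S \ T, f i + ∑ i ∈ T, f i := fun f => by
    rw [hU, ← Finset.sdiff_union_self_eq_union, Finset.sum_union Finset.sdiff_disjoint]
  set f := √(∑ i ∈ S \ T, (a i - q i) ^ 2) with hf
  set D := √(∑ i ∈ T, q i ^ 2) with hD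
  set e := √(∑ i ∈ S \ T, q i ^ 2) with he
  have hfsq : f ^ 2 = ∑ i ∈ S \ T, (a i - q i) ^ 2 := Real.sq_sqrt (by positivity)
  have hDsq : D ^ 2 = ∑ i ∈ T, q i ^ 2 := Real.sq_sqrt (by positivity)
  have hesq : e ^ 2 = ∑ i ∈ S \ T, q i ^ 2 := Real.sq_sqrt (by positivity)
  have hU1 : ∑ i ∈ U, (a i - q i) ^ 2 = f ^ 2 + D ^ 2 := by
    rw [hsplit, hfsq, hDsq]
    congr 1
    exact Finset.sum_congr rfl fun t ht => by rw [hresT t ht]; ring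
  have hU2 : l2norm q ^ 2 = e ^ 2 + D ^ 2 := by
    rw [l2norm_sq, hqU.dotProduct_eq, hsplit, hesq, hDsq]
    simp only [sq]
  have hle : e ≤ f + κ * D := by
    have h1 : √(∑ i ∈ S \ T, a i ^ 2) ≤ κ * D := by
      refine (Real.sqrt_le_sqrt hsel).trans_eq ?_
      rw [Real.sqrt_mul (sq_nonneg _), Real.sqrt_sq hκ0.le]
      rfl
    have h2 := sqrt_sum_add_sq_le (S \ T) (fun i => -(a i - q i)) a
    simp only [neg_sub, sub_add_cancel] at h2
    have h3 : √(∑ i ∈ S \ T, (q i - a i) ^ 2) = f := by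
      rw [hf]
      congr 1
      exact Finset.sum_congr rfl fun i _ => by ring
    rw [h3] at h2
    linarith
  have hf0 : 0 ≤ f := Real.sqrt_nonneg _
  have hD0 : 0 ≤ D := Real.sqrt_nonneg _
  have he0 : 0 ≤ e := Real.sqrt_nonneg _
  -- `r` is the smallest singular value of the shear `(e, D) ↦ (e - κ D, D)`. After substituting the
  -- bound on `r e`, the difference of the two sides is `(1 - r²)(f - r D)²`.
  have hmain : (r * l2norm q) ^ 2 ≤ f ^ 2 + D ^ 2 := by
    rw [mul_pow, hU2]
    have h1 : r * e ≤ r * f + (1 - r ^ 2) * D := by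
      rw [← hκ]; nlinarith
    have h2 : (r * e) ^ 2 ≤ (r * f + (1 - r ^ 2) * D) ^ 2 :=
      pow_le_pow_left₀ (by positivity) h1 2
    nlinarith [mul_nonneg (show 0 ≤ 1 - r ^ 2 by nlinarith) (sq_nonneg (f - r * D))]
  have hfin : r * l2norm q ≤ δ * l2norm q + √(s : ℝ) * τ := by
    refine le_trans ?_ htri
    rw [hU1]
    exact Real.le_sqrt_of_sq_le hmain
  linarith

end Stability

/-! ### Invariants and termination of the two algorithms, and what outputs satisfy. -/

section Runs

variable {m n : ℕ} {M : Matrix (Fin m) (Fin n) ℝ} {y : Fin m → ℝ} {k : ℕ}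

/-- A support with `k` atoms that is left by removing a least contributing atom `j` of `V`,
no other atom having a larger gain. -/
def IsStationary (M : Matrix (Fin m) (Fin n) ℝ) (y : Fin m → ℝ) (k : ℕ) (T : Finset (Fin n)) :
    Prop :=
  ∃ (V : Finset (Fin n)) (j : V), V.card = k + 1 ∧ T = V.erase j ∧ IsLeastAtom M y V j ∧
    ∀ i ∉ T, gain M y T i ≤ contribution M y V j

/-- What is known about every returned support. -/
def IsOutput (M : Matrix (Fin m) (Fin n) ℝ) (y : Fin m → ℝ) (k : ℕ) (T : Finset (Fin n)) : Prop :=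
  (T.card ≤ k ∧ resProj M T *ᵥ y = 0) ∨ IsStationary M y k T

/-- The invariant of OLSR. -/
def OLSRState.Valid (M : Matrix (Fin m) (Fin n) ℝ) (y : Fin m → ℝ) (k : ℕ) : OLSRState n → Prop
  | .init T => T.card ≤ k + 1
  | .loop T => T.card = k + 1
  | .done T => IsOutput M y k T

/-- The invariant of IOLSR. -/
def IOLSRState.Valid (M : Matrix (Fin m) (Fin n) ℝ) (y : Fin m → ℝ) (k : ℕ) : IOLSRState n → Prop
  | .loop T => T.card ≤ k
  | .done T => IsOutput M y k T

/-- A quantity that increases along OLSR: the phase, the captured energy, the support size. -/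
def OLSRState.rank (M : Matrix (Fin m) (Fin n) ℝ) (y : Fin m → ℝ) : OLSRState n → ℕ ×ₗ ℝ ×ₗ ℕ
  | .init T => toLex (0, toLex (energy M y T, T.card))
  | .loop T => toLex (1, toLex (energy M y T, T.card))
  | .done T => toLex (2, toLex (energy M y T, T.card))

/-- A quantity that increases along IOLSR: the phase, the captured energy, the support size. -/
def IOLSRState.rank (M : Matrix (Fin m) (Fin n) ℝ) (y : Fin m → ℝ) : IOLSRState n → ℕ ×ₗ ℝ ×ₗ ℕ
  | .loop T => toLex (0, toLex (energy M y T, T.card))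
  | .done T => toLex (1, toLex (energy M y T, T.card))

instance : Finite (OLSRState n) :=
  Finite.of_surjective (fun p : Fin 3 × Finset (Fin n) =>
    if p.1 = 0 then OLSRState.init p.2 else if p.1 = 1 then .loop p.2 else .done p.2) (by
      rintro (T | T | T)
      · exact ⟨(0, T), rfl⟩
      · exact ⟨(1, T), rfl⟩
      · exact ⟨(2, T), rfl⟩)

instance : Finite (IOLSRState n) :=
  Finite.of_surjective (fun p : Fin 2 × Finset (Fin n) =>
    if p.1 = 0 then IOLSRState.loop p.2 else .done p.2) (by
      rintro (T | T)
      · exact ⟨(0, T), rfl⟩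
      · exact ⟨(1, T), rfl⟩)

/-- Over a finite state space, a quantity that increases along the valid steps excludes infinite
runs. -/
lemma alwaysHalts_of_rank {S α : Type} [Finite S] [Preorder α] {step : S → S → Prop}
    {final : S → Prop} (valid : S → Prop) (rank : S → α)
    (hstep : ∀ s s', valid s → step s s' → valid s' ∧ rank s < rank s')
    (hprog : ∀ s, valid s → final s ∨ ∃ s', step s s') {s₀ : S} (h₀ : valid s₀) :
    AlwaysHalts step final s₀ := by
  have hwf : WellFounded fun s' s : S => rank s < rank s' :=
    @Finite.wellFounded_of_trans_of_irrefl S _ _ ⟨fun _ _ _ h1 h2 => lt_trans h2 h1⟩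
      ⟨fun _ => lt_irrefl _⟩
  constructor
  · induction s₀ using hwf.induction with
    | _ s ih => exact ⟨_, fun s' hs' => ih s' (hstep s s' h₀ hs').2 (hstep s s' h₀ hs').1⟩
  · intro s hs
    refine hprog s ?_
    induction hs with
    | refl => exact h₀
    | tail _ h ih => exact (hstep _ _ ih h).1

lemma exists_isBestAtom {T : Finset (Fin n)} (hT : T.card < n) : ∃ i, IsBestAtom M y T i := by
  have hne : (Tᶜ).Nonempty := by
    rw [← Finset.card_pos, Finset.card_compl, Fintype.card_fin]
    omega
  obtain ⟨i, hi, hmax⟩ := (Tᶜ).exists_max_image (gain M y T) hne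
  exact ⟨i, Finset.mem_compl.1 hi, fun i' hi' => hmax i' (Finset.mem_compl.2 hi')⟩

lemma exists_isLeastAtom {T : Finset (Fin n)} (hT : T.Nonempty) : ∃ j, IsLeastAtom M y T j := by
  have : Nonempty T := hT.to_subtype
  exact Finite.exists_min (contribution M y T)

lemma energy_le_insert (hind : ∀ T : Finset (Fin n), T.card ≤ k + 1 → Indep M T)
    (hunit : ∀ j, l2norm (M.col j) = 1) {T : Finset (Fin n)} {i : Fin n} (hi : i ∉ T)
    (hT : T.card ≤ k) : energy M y T ≤ energy M y (insert i T) := by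
  have h := hind (insert i T) ((Finset.card_insert_le _ _).trans (by omega))
  rw [h.energy_insert hi hunit, h.gain_insert hi hunit]
  linarith [h.contribution_nonneg (y := y) hunit ⟨i, Finset.mem_insert_self i T⟩]

lemma OLSRStep.valid_rank (hind : ∀ T : Finset (Fin n), T.card ≤ k + 1 → Indep M T)
    (hunit : ∀ j, l2norm (M.col j) = 1) {s s' : OLSRState n} (hs : s.Valid M y k)
    (h : OLSRStep M y k s s') : s'.Valid M y k ∧ s.rank M y < s'.rank M y := by
  cases h with
  | add T i hcard hres hi =>
    have hc := Finset.card_insert_of_notMem hi.1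
    have he := energy_le_insert (y := y) hind hunit hi.1 (by omega)
    refine ⟨by simp only [OLSRState.Valid]; omega, ?_⟩
    refine Prod.Lex.toLex_lt_toLex.2 (Or.inr ⟨rfl, Prod.Lex.toLex_lt_toLex.2 ?_⟩)
    rcases he.lt_or_eq with he | he
    · exact Or.inl he
    -- A nonzero residual may be orthogonal to all atoms; then the gain is 0 and only the support
    -- size increases.
    · exact Or.inr ⟨he, by dsimp only; omega⟩
  | early T hcard hres =>
    exact ⟨Or.inl ⟨hcard, hres⟩, Prod.Lex.toLex_lt_toLex.2 (Or.inl (by norm_num))⟩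
  | enter T hcard =>
    exact ⟨hcard, Prod.Lex.toLex_lt_toLex.2 (Or.inl (by norm_num))⟩
  | replace T j i hj hi hlt =>
    have hT : T.card = k + 1 := hs
    have hc := Finset.card_insert_of_notMem hi.1
    have hc' := Finset.card_erase_of_mem j.2
    have h1 := (hind (insert i (T.erase j)) (by omega)).energy_insert (y := y) hi.1 hunit
    have h2 := (hind T hT.le).energy_erase (y := y) hunit j
    refine ⟨by simp only [OLSRState.Valid]; omega, ?_⟩
    exact Prod.Lex.toLex_lt_toLex.2
      (Or.inr ⟨rfl, Prod.Lex.toLex_lt_toLex.2 (Or.inl (by dsimp only; linarith))⟩)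
  | quit T j i hj hi hle =>
    exact ⟨Or.inr ⟨T, j, hs, rfl, hj, fun i' hi' => (hi.2 i' hi').trans hle⟩,
      Prod.Lex.toLex_lt_toLex.2 (Or.inl (by norm_num))⟩

lemma IOLSRStep.valid_rank (hind : ∀ T : Finset (Fin n), T.card ≤ k + 1 → Indep M T)
    (hunit : ∀ j, l2norm (M.col j) = 1) {s s' : IOLSRState n} (hs : s.Valid M y k)
    (h : IOLSRStep M y k s s') : s'.Valid M y k ∧ s.rank M y < s'.rank M y := by
  cases h with
  | replace T i j hcard hi hj hne =>
    have hT : T.card ≤ k := hs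
    have hc := Finset.card_insert_of_notMem hi.1
    have hc' := Finset.card_erase_of_mem j.2
    have hI := hind (insert i T) (by omega)
    have h1 := hI.energy_insert (y := y) hi.1 hunit
    have h2 := hI.energy_erase (y := y) hunit j
    -- Strictness comes from the tie rule: were the contributions equal, `i` would also be least and
    -- no replacement would occur.
    have h3 : contribution M y (insert i T) j < gain M y T i := by
      rw [hI.gain_insert hi.1 hunit]
      refine lt_of_le_of_ne (hj _) fun he => hne fun j' => ?_
      rw [← he]
      exact hj j'
    refine ⟨by simp only [IOLSRState.Valid]; omega, ?_⟩
    exact Prod.Lex.toLex_lt_toLex.2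
      (Or.inr ⟨rfl, Prod.Lex.toLex_lt_toLex.2 (Or.inl (by dsimp only; linarith))⟩)
  | grow T i hi hleast hcard =>
    have hT : T.card ≤ k := hs
    have hc := Finset.card_insert_of_notMem hi.1
    have he := energy_le_insert (y := y) hind hunit hi.1 hT
    refine ⟨by simp only [IOLSRState.Valid]; omega, ?_⟩
    refine Prod.Lex.toLex_lt_toLex.2 (Or.inr ⟨rfl, Prod.Lex.toLex_lt_toLex.2 ?_⟩)
    rcases he.lt_or_eq with he | he
    · exact Or.inl he
    · exact Or.inr ⟨he, by dsimp only; omega⟩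
  | finish T i hi hleast hcard =>
    refine ⟨Or.inr ⟨insert i T, ⟨i, Finset.mem_insert_self i T⟩, hcard, rfl, hleast, ?_⟩,
      Prod.Lex.toLex_lt_toLex.2 (Or.inl (by norm_num))⟩
    -- The discarded atom is the one just added, so its contribution is the maximal gain over `T`.
    rw [← (hind _ hcard.le).gain_insert hi.1 hunit, Finset.erase_insert hi.1]
    exact hi.2

lemma olsrHalts (hind : ∀ T : Finset (Fin n), T.card ≤ k + 1 → Indep M T)
    (hunit : ∀ j, l2norm (M.col j) = 1) (hkn : k < n) : OLSRHalts M y k := by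
  refine alwaysHalts_of_rank (OLSRState.Valid M y k) (OLSRState.rank M y)
    (fun s s' hs h => h.valid_rank hind hunit hs) ?_ (by simp [OLSRState.Valid])
  rintro (T | T | T) hT
  · right
    rcases Nat.lt_or_ge T.card (k + 1) with hlt | hge
    · by_cases hres : resProj M T *ᵥ y = 0
      · exact ⟨_, .early T (by omega) hres⟩
      · obtain ⟨i, hi⟩ := exists_isBestAtom (M := M) (y := y) (T := T) (by omega)
        exact ⟨_, .add T i hlt hres hi⟩
    · exact ⟨_, .enter T (le_antisymm hT hge)⟩
  · right
    have hT : T.card = k + 1 := hT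
    obtain ⟨j, hj⟩ := exists_isLeastAtom (M := M) (y := y) (T := T)
      (Finset.card_pos.1 (by omega))
    have hc := Finset.card_erase_of_mem j.2
    obtain ⟨i, hi⟩ := exists_isBestAtom (M := M) (y := y) (T := T.erase j) (by omega)
    rcases lt_or_ge (contribution M y T j) (gain M y (T.erase j) i) with h | h
    · exact ⟨_, .replace T j i hj hi h⟩
    · exact ⟨_, .quit T j i hj hi h⟩
  · exact Or.inl ⟨T, rfl⟩

lemma iolsrHalts (hind : ∀ T : Finset (Fin n), T.card ≤ k + 1 → Indep M T)
    (hunit : ∀ j, l2norm (M.col j) = 1) (hkn : k < n) : IOLSRHalts M y k := by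
  refine alwaysHalts_of_rank (IOLSRState.Valid M y k) (IOLSRState.rank M y)
    (fun s s' hs h => h.valid_rank hind hunit hs) ?_ (by simp [IOLSRState.Valid])
  rintro (T | T) hT
  · right
    have hT : T.card ≤ k := hT
    obtain ⟨i, hi⟩ := exists_isBestAtom (M := M) (y := y) (T := T) (by omega)
    have hc := Finset.card_insert_of_notMem hi.1
    by_cases hleast : IsLeastAtom M y (insert i T) ⟨i, Finset.mem_insert_self i T⟩
    · rcases Nat.lt_or_ge (insert i T).card (k + 1) with hlt | hge
      · exact ⟨_, .grow T i hi hleast hlt⟩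
      · exact ⟨_, .finish T i hi hleast (by omega)⟩
    · obtain ⟨j, hj⟩ := exists_isLeastAtom (M := M) (y := y) (Finset.insert_nonempty i T)
      exact ⟨_, .replace T i j (by omega) hi hj hleast⟩
  · exact Or.inl ⟨T, rfl⟩

lemma OLSRReturns.isOutput (hind : ∀ T : Finset (Fin n), T.card ≤ k + 1 → Indep M T)
    (hunit : ∀ j, l2norm (M.col j) = 1) {T : Finset (Fin n)} (h : OLSRReturns M y k T) :
    IsOutput M y k T := by
  suffices ∀ s, Relation.ReflTransGen (OLSRStep M y k) (.init ∅) s → s.Valid M y k from this _ h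
  intro s hs
  induction hs with
  | refl => simp [OLSRState.Valid]
  | tail _ h ih => exact (h.valid_rank hind hunit ih).1

lemma IOLSRReturns.isOutput (hind : ∀ T : Finset (Fin n), T.card ≤ k + 1 → Indep M T)
    (hunit : ∀ j, l2norm (M.col j) = 1) {T : Finset (Fin n)} (h : IOLSRReturns M y k T) :
    IsOutput M y k T := by
  suffices ∀ s, Relation.ReflTransGen (IOLSRStep M y k) (.loop ∅) s → s.Valid M y k from this _ h
  intro s hs
  induction hs with
  | refl => simp [IOLSRState.Valid]
  | tail _ h ih => exact (h.valid_rank hind hunit ih).1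

/-- The missed atoms of an output correlate weakly with the residual. -/
lemma IsOutput.sum_sq_le {δ : ℝ} (h : RIP M (2 * k) δ) (hδ0 : 0 ≤ δ) (hδ : δ < 1) (hk : 1 ≤ k)
    (hunit : ∀ j, l2norm (M.col j) = 1) {x : Fin n → ℝ} {S : Finset (Fin n)} (hx : SuppOn S x)
    (hS : S.card = k) {κ : ℝ} (hκ : 0 < κ) (hκ' : 1 + 2 * (δ / (1 - δ ^ 2)) * κ ≤ κ ^ 2)
    {T : Finset (Fin n)} (hT : IsOutput M y k T) :
    ∑ i ∈ S \ T, (M.col i ⬝ᵥ (resProj M T *ᵥ y)) ^ 2 ≤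
      κ ^ 2 * ∑ t ∈ T, (x t - estimate M y T t) ^ 2 := by
  rcases hT with ⟨_, h0⟩ | ⟨V, j, hV, rfl, hj, hgain⟩
  · simp only [h0, dotProduct_zero, ne_eq, OfNat.ofNat_ne_zero, not_false_eq_true, zero_pow,
      Finset.sum_const_zero]
    positivity
  · set T := V.erase j with hTdef
    have hT : T.card = k := by rw [hTdef, Finset.card_erase_of_mem j.2, hV]; rfl
    -- Equal cardinality lets each missed atom be paid for by a false one, where `x` vanishes and
    -- the error is the estimate itself.
    have hcard : (S \ T).card = (T \ S).card := by
      have h1 := Finset.card_sdiff_add_card_inter S T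
      have h2 := Finset.card_sdiff_add_card_inter T S
      rw [Finset.inter_comm] at h2
      omega
    calc ∑ i ∈ S \ T, (M.col i ⬝ᵥ (resProj M T *ᵥ y)) ^ 2
        ≤ ∑ _i ∈ S \ T, contribution M y V j := by
          refine Finset.sum_le_sum fun i hi => ?_
          have hiT := (Finset.mem_sdiff.1 hi).2
          have hI : Indep M (insert i T) := h.indep hδ (by
            rw [Finset.card_insert_of_notMem hiT]; omega)
          exact (hI.sq_col_dotProduct_le hiT hunit).trans (hgain i hiT)
      _ = ∑ _t ∈ T \ S, contribution M y V j := by rw [Finset.sum_const, Finset.sum_const, hcard]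
      _ ≤ ∑ t ∈ T \ S, κ ^ 2 * (x t - estimate M y T t) ^ 2 := by
          refine Finset.sum_le_sum fun t ht => ?_
          obtain ⟨htT, htS⟩ := Finset.mem_sdiff.1 ht
          rw [hx t htS, zero_sub, neg_sq]
          exact h.contribution_le_estimate_sq hδ0 hδ hunit (by omega) hj hκ hκ' htT
      _ ≤ κ ^ 2 * ∑ t ∈ T, (x t - estimate M y T t) ^ 2 := by
          rw [Finset.mul_sum]
          exact Finset.sum_le_sum_of_subset_of_nonneg Finset.sdiff_subset
            fun _ _ _ => by positivity

lemma IsOutput.card_le {T : Finset (Fin n)} (hT : IsOutput M y k T) : T.card ≤ k := by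
  rcases hT with ⟨h, _⟩ | ⟨V, j, hV, rfl, _, _⟩
  · exact h
  · rw [Finset.card_erase_of_mem j.2, hV]; rfl

/-! ### Explicit constants and the deterministic error bound. -/

lemma delta_lt {δ : ℝ} (hδ0 : 0 ≤ δ) (hδ : δ < 1) (h : 0 < (1 - δ) * (1 - δ ^ 2) - δ) :
    δ < 0.446 := by
  by_contra! hc
  -- The cubic `1 - 2δ - δ² + δ³` decreases on `[0, 1]` and is already negative at `0.446`.
  nlinarith [mul_nonneg hδ0 (sub_nonneg.2 hδ.le)]

/-- The best `r` is algebraic in `δ`, equal to `(√5 - 1) / 2` at `δ = 0`. The linear function is a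
feasible replacement that still exceeds `δ` up to `0.446`. -/
lemma kappa_condition {δ r κ : ℝ} (hδ0 : 0 ≤ δ) (hδ : δ < 0.446) (hr : r = 0.61 - 0.34 * δ)
    (hκ : κ * r = 1 - r ^ 2) : 1 + 2 * (δ / (1 - δ ^ 2)) * κ ≤ κ ^ 2 := by
  have hr0 : 0 < r := by rw [hr]; linarith
  have hd : 0 < 1 - δ ^ 2 := by nlinarith
  obtain rfl : κ = (1 - r ^ 2) / r := by rw [← hκ]; field_simp
  have e : 1 + 2 * (δ / (1 - δ ^ 2)) * ((1 - r ^ 2) / r) =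
      ((1 - δ ^ 2) * r ^ 2 + 2 * δ * r * (1 - r ^ 2)) / ((1 - δ ^ 2) * r ^ 2) := by
    field_simp
  rw [e, div_pow, div_le_div_iff₀ (by positivity) (by positivity)]
  have key : 0 ≤ ((1 - r ^ 2) ^ 2 - r ^ 2) * (1 - δ ^ 2) - 2 * δ * r * (1 - r ^ 2) := by
    have hβ : 0 ≤ 0.446 - δ := by linarith
    -- The claim is a polynomial inequality of degree 6 in `δ`; the hints are the Bernstein basis of
    -- that degree on `[0, 0.446]`, up to scaling.
    rw [hr]
    nlinarith only [mul_nonneg (pow_nonneg hδ0 0) (pow_nonneg hβ 6),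
      mul_nonneg (pow_nonneg hδ0 1) (pow_nonneg hβ 5),
      mul_nonneg (pow_nonneg hδ0 2) (pow_nonneg hβ 4),
      mul_nonneg (pow_nonneg hδ0 3) (pow_nonneg hβ 3),
      mul_nonneg (pow_nonneg hδ0 4) (pow_nonneg hβ 2),
      mul_nonneg (pow_nonneg hδ0 5) (pow_nonneg hβ 1),
      mul_nonneg (pow_nonneg hδ0 6) (pow_nonneg hβ 0)]
  nlinarith [mul_nonneg key (sq_nonneg r)]

lemma sqrt_two_le_c₂ {δ : ℝ} (hδ0 : 0 ≤ δ) (hδ : δ < 1) (h : 0 < (1 - δ) * (1 - δ ^ 2) - δ) :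
    √2 ≤ c₂ δ * (0.61 - 0.34 * δ - δ) := by
  have hδ' := delta_lt hδ0 hδ h
  have hr : 0 < 0.61 - 0.34 * δ - δ := by linarith
  have h2 : √2 ≤ 1.4143 := Real.sqrt_le_iff.2 ⟨by norm_num, by norm_num⟩
  -- A linear minorant, valid for `0 ≤ δ ≤ 5/9`, makes the remaining inequality rational.
  have hsq : 1 - 0.6 * δ ≤ √(1 - δ) := Real.le_sqrt_of_sq_le (by nlinarith)
  have hc : (1 + δ ^ 2) * (2 - 0.6 * δ) / ((1 - δ) * (1 - δ ^ 2) - δ) + 1 / (1 - δ) ≤ c₂ δ := by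
    unfold c₂
    gcongr
    linarith
  refine h2.trans (le_trans ?_ (mul_le_mul_of_nonneg_right hc hr.le))
  rw [div_add_div _ _ h.ne' (by linarith), div_mul_eq_mul_div,
    le_div_iff₀ (mul_pos h (by linarith))]
  have hβ : 0 ≤ 0.446 - δ := by linarith
  nlinarith only [mul_nonneg (pow_nonneg hδ0 0) (pow_nonneg hβ 6),
    mul_nonneg (pow_nonneg hδ0 1) (pow_nonneg hβ 5),
    mul_nonneg (pow_nonneg hδ0 2) (pow_nonneg hβ 4),
    mul_nonneg (pow_nonneg hδ0 3) (pow_nonneg hβ 3),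
    mul_nonneg (pow_nonneg hδ0 4) (pow_nonneg hβ 2),
    mul_nonneg (pow_nonneg hδ0 5) (pow_nonneg hβ 1),
    mul_nonneg (pow_nonneg hδ0 6) (pow_nonneg hβ 0)]

/-- The worst-case error bound on the event that the noise correlates weakly with all atoms. -/
lemma IsOutput.error_le {δ : ℝ} (h : RIP M (2 * k) δ) (hδ0 : 0 ≤ δ) (hδ : δ < 1) (hk : 1 ≤ k)
    (hδpos : 0 < (1 - δ) * (1 - δ ^ 2) - δ)
    (hunit : ∀ j, l2norm (M.col j) = 1) {x : Fin n → ℝ} (hx : hammingNorm x = k)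
    {w : Fin m → ℝ} {τ : ℝ} (hτ : 0 ≤ τ) (hw : ∀ i, |M.col i ⬝ᵥ w| ≤ τ) (hy : y = M *ᵥ x + w)
    {T : Finset (Fin n)} (hT : IsOutput M y k T) :
    l2norm (x - estimate M y T) ≤ c₂ δ * (√k * τ) := by
  classical
  set S : Finset (Fin n) := Finset.univ.filter fun i => x i ≠ 0 with hS
  have hxS : SuppOn S x := fun i hi => by simpa [hS] using hi
  have hScard : S.card = k := hx
  have hδ' := delta_lt hδ0 hδ hδpos
  set r := 0.61 - 0.34 * δ with hr
  have hr0 : δ < r := by rw [hr]; linarith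
  have hr1 : r < 1 := by rw [hr]; linarith
  have hκ : (1 - r ^ 2) / r * r = 1 - r ^ 2 := div_mul_cancel₀ _ (by linarith)
  have hκ0 : 0 < (1 - r ^ 2) / r := div_pos (by nlinarith) (by linarith)
  have hTk := hT.card_le
  have h1 := h.estimate_error_le hδ0 (h.indep hδ (by omega)) hxS
    ((Finset.card_union_le S T).trans (by omega)) hτ hw hy (by linarith) hr1 hκ
    (hT.sum_sq_le h hδ0 hδ hk hunit hxS hScard hκ0 (kappa_condition hδ0 hδ' hr hκ))
  have h2 := sqrt_two_le_c₂ hδ0 hδ hδpos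
  rw [← hr] at h2
  have h3 : (r - δ) * l2norm (x - estimate M y T) ≤ (r - δ) * (c₂ δ * (√k * τ)) := by
    refine h1.trans ?_
    push_cast
    -- The union of the two supports has up to `2k` atoms; the resulting `√2` is absorbed by `c₂ δ *
    -- (r - δ)`.
    rw [Real.sqrt_mul zero_le_two]
    have : 0 ≤ √(k : ℝ) * τ := by positivity
    nlinarith
  exact le_of_mul_le_mul_left h3 (by linarith)

end Runs

/-! ### Gaussian tails and the high-probability event. -/

section Noise

/-- A linear combination of independent centred Gaussian variables of equal variance. -/
lemma hasLaw_sum_mul_gaussian {Ω ι : Type*} [MeasurableSpace Ω] {P : Measure Ω}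
    [IsProbabilityMeasure P] {v : ℝ≥0} {w : ι → Ω → ℝ} (hw : iIndepFun w P)
    (hlaw : ∀ i, HasLaw (w i) (gaussianReal 0 v) P) (c : ι → ℝ) (s : Finset ι) :
    HasLaw (fun ω => ∑ i ∈ s, c i * w i ω)
      (gaussianReal 0 ((∑ i ∈ s, .mk (c i ^ 2) (sq_nonneg _)) * v)) P := by
  classical
  have hc : ∀ i, HasLaw (fun ω => c i * w i ω)
      (gaussianReal 0 (.mk (c i ^ 2) (sq_nonneg _) * v)) P := fun i => by
    simpa using gaussianReal_const_mul (hlaw i) (c i)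
  have hind : iIndepFun (fun i ω => c i * w i ω) P :=
    hw.comp (fun i x => c i * x) fun i => measurable_const_mul (c i)
  induction s using Finset.induction_on with
  | empty =>
    simp only [Finset.sum_empty, zero_mul, gaussianReal_zero_var]
    exact ⟨aemeasurable_const, by rw [Measure.map_const]; simp⟩
  | insert i s hi ih =>
    have h1 := hind.indepFun_finsetSum_of_notMem₀ (fun i => (hc i).aemeasurable) hi
    have h2 : (∑ j ∈ s, fun ω => c j * w j ω) = fun ω => ∑ j ∈ s, c j * w j ω := by
      ext ω; simp
    rw [h2] at h1
    have h3 := gaussianReal_add_gaussianReal_of_indepFun h1.symm (hc i).map_eq ih.map_eq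
    rw [add_zero, ← add_mul] at h3
    refine ⟨(Finset.aemeasurable_fun_sum _ fun i _ => (hc i).aemeasurable), ?_⟩
    rw [Finset.sum_insert hi, ← h3]
    congr 1
    ext ω
    simp [Finset.sum_insert hi]

lemma hasDerivAt_gaussianPDFReal {v : ℝ≥0} (hv : v ≠ 0) (x : ℝ) :
    HasDerivAt (fun x => -(v * gaussianPDFReal 0 v x)) (x * gaussianPDFReal 0 v x) x := by
  have hv' : (v : ℝ) ≠ 0 := by exact_mod_cast hv
  have h1 : HasDerivAt (fun x : ℝ => -(x - 0) ^ 2 / (2 * v)) (-x / v) x := by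
    have := (((hasDerivAt_id x).sub_const 0).pow 2).neg.div_const (2 * (v : ℝ))
    refine this.congr_deriv ?_
    simp only [id]
    field_simp
    ring
  have h2 := ((h1.exp.const_mul ((√(2 * Real.pi * v))⁻¹)).const_mul (v : ℝ)).neg
  refine h2.congr_deriv ?_
  simp only [gaussianPDFReal]
  field_simp

lemma tendsto_gaussianPDFReal {v : ℝ≥0} (hv : v ≠ 0) :
    Filter.Tendsto (fun x => -(v * gaussianPDFReal 0 v x)) Filter.atTop (nhds 0) := by
  have hv' : 0 < (v : ℝ) := by exact_mod_cast pos_iff_ne_zero.2 hv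
  have h1 : Filter.Tendsto (fun x : ℝ => -(x - 0) ^ 2 / (2 * v)) Filter.atTop Filter.atBot := by
    have : (fun x : ℝ => -(x - 0) ^ 2 / (2 * v)) =
        fun x : ℝ => -(x ^ 2 / (2 * v)) := by
      ext x; ring
    rw [this]
    exact Filter.tendsto_neg_atTop_atBot.comp
      ((Filter.tendsto_pow_atTop two_ne_zero).atTop_div_const (by positivity))
  have h2 := (((Real.tendsto_exp_atBot.comp h1).const_mul ((√(2 * Real.pi * v))⁻¹)).const_mul
    (v : ℝ)).neg
  simpa [gaussianPDFReal] using h2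

/-- The strict Mills bound for the upper Gaussian tail. -/
lemma integral_Ioi_gaussianPDFReal_lt {v : ℝ≥0} (hv : v ≠ 0) {t : ℝ} (ht : 0 < t) :
    ∫ x in Set.Ioi t, gaussianPDFReal 0 v x < v / t * gaussianPDFReal 0 v t := by
  have hnn : ∀ x ∈ Set.Ioi t, 0 ≤ x * gaussianPDFReal 0 v x := fun x hx =>
    mul_nonneg (ht.trans hx).le (gaussianPDFReal_nonneg _ _ _)
  have hint := integral_Ioi_of_hasDerivAt_of_nonneg'
    (fun x _ => hasDerivAt_gaussianPDFReal hv x) hnn (tendsto_gaussianPDFReal hv)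
  have hI := integrableOn_Ioi_deriv_of_nonneg'
    (fun x _ => hasDerivAt_gaussianPDFReal hv x) hnn (tendsto_gaussianPDFReal hv)
  have hI' : IntegrableOn (gaussianPDFReal 0 v) (Set.Ioi t) :=
    (integrable_gaussianPDFReal 0 v).integrableOn
  -- Strict positivity of the integral of `(x - t)` against the density, whose first part integrates
  -- to `v` times the density at `t`, is the strict Mills bound.
  have hpos : 0 < ∫ x in Set.Ioi t, (x * gaussianPDFReal 0 v x - t * gaussianPDFReal 0 v x) := by
    have hp : ∀ x ∈ Set.Ioi t, 0 < x * gaussianPDFReal 0 v x - t * gaussianPDFReal 0 v x :=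
      fun x hx => by
        rw [← sub_mul]
        exact mul_pos (sub_pos.2 hx) (gaussianPDFReal_pos _ _ _ hv)
    rw [setIntegral_pos_iff_support_of_nonneg_ae
      ((ae_restrict_iff' measurableSet_Ioi).2 (ae_of_all _ fun x hx => (hp x hx).le))
      (hI.sub (hI'.const_mul t)), Set.inter_eq_right.2
      (show Set.Ioi t ⊆ Function.support _ from fun x hx => (hp x hx).ne'), Real.volume_Ioi]
    exact ENNReal.zero_lt_top
  rw [integral_sub hI (hI'.const_mul t), hint, integral_const_mul] at hpos
  rw [div_mul_eq_mul_div, lt_div_iff₀ ht]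
  linarith

lemma gaussianReal_abs_gt_lt {v : ℝ≥0} (hv : v ≠ 0) {t : ℝ} (ht : 0 < t) :
    (gaussianReal 0 v).real {x | t < |x|} < 2 * (v / t * gaussianPDFReal 0 v t) := by
  have h1 : (gaussianReal 0 v).real (Set.Ioi t) < v / t * gaussianPDFReal 0 v t := by
    rw [measureReal_def, gaussianReal_apply_eq_integral _ hv, ENNReal.toReal_ofReal
      (setIntegral_nonneg measurableSet_Ioi fun x _ => gaussianPDFReal_nonneg _ _ _)]
    exact integral_Ioi_gaussianPDFReal_lt hv ht
  have h2 : (gaussianReal 0 v).real (Set.Iio (-t)) = (gaussianReal 0 v).real (Set.Ioi t) := by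
    have h := gaussianReal_map_neg (μ := 0) (v := v)
    rw [neg_zero] at h
    conv_rhs => rw [← h]
    rw [map_measureReal_apply measurable_neg measurableSet_Ioi]
    congr 1
    ext x
    simp
  have h3 : {x : ℝ | t < |x|} = Set.Ioi t ∪ Set.Iio (-t) := by
    ext x
    simp [lt_abs, lt_neg (a := t)]
  rw [h3]
  refine (measureReal_union_le _ _).trans_lt ?_
  rw [h2]
  linarith

/-- The threshold is chosen so that the exponential equals `N^{-(1+a)}`: one factor `1/N` pays for
the union bound, and `N^{-a}` remains. -/
lemma mills_value {σ : ℝ≥0} (hσ : σ ≠ 0) {N a : ℝ} (hN : 1 < N) (ha : 0 ≤ a) :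
    2 * (((σ ^ 2 : ℝ≥0) : ℝ) / (σ * √(2 * (1 + a) * Real.log N)) *
      gaussianPDFReal 0 (σ ^ 2) (σ * √(2 * (1 + a) * Real.log N))) =
      (√(Real.pi * (1 + a) * Real.log N) * N ^ a)⁻¹ / N := by
  have hL : 0 < Real.log N := Real.log_pos hN
  have hN0 : 0 < N := by linarith
  have hσ' : 0 < (σ : ℝ) := by exact_mod_cast pos_iff_ne_zero.2 hσ
  have ha' : 0 < 1 + a := by linarith
  have hpi := Real.pi_pos
  set L := Real.log N with hLdef
  have e1 : Real.exp (-(σ * √(2 * (1 + a) * L) - 0) ^ 2 / (2 * ((σ ^ 2 : ℝ≥0) : ℝ))) =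
      (N ^ a)⁻¹ * N⁻¹ := by
    rw [sub_zero, mul_pow, Real.sq_sqrt (by positivity), Real.rpow_def_of_pos hN0, ← hLdef]
    conv_rhs => rw [← Real.exp_log hN0, ← hLdef, ← Real.exp_neg, ← Real.exp_neg, ← Real.exp_add]
    congr 1
    push_cast
    field_simp
    ring
  have e2 : √(2 * (1 + a) * L) * √(2 * Real.pi * ((σ ^ 2 : ℝ≥0) : ℝ)) =
      2 * σ * √(Real.pi * (1 + a) * L) := by
    rw [← Real.sqrt_mul (by positivity)]
    push_cast
    rw [show 2 * (1 + a) * L * (2 * Real.pi * (σ : ℝ) ^ 2) =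
      (2 * σ) ^ 2 * (Real.pi * (1 + a) * L) by ring, Real.sqrt_mul (by positivity),
      Real.sqrt_sq (by positivity)]
  rw [gaussianPDFReal, e1]
  have h1 : 0 < √(2 * (1 + a) * L) := Real.sqrt_pos.2 (by positivity)
  have h2 : 0 < √(2 * Real.pi * ((σ ^ 2 : ℝ≥0) : ℝ)) :=
    Real.sqrt_pos.2 (by push_cast; positivity)
  have h3 : 0 < √(Real.pi * (1 + a) * L) := Real.sqrt_pos.2 (by positivity)
  have h4 : 0 < N ^ a := Real.rpow_pos_of_pos hN0 a
  generalize √(2 * (1 + a) * L) = A at *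
  generalize √(2 * Real.pi * ((σ ^ 2 : ℝ≥0) : ℝ)) = B at *
  generalize √(Real.pi * (1 + a) * L) = C at *
  generalize N ^ a = D at *
  push_cast
  have e3 : 2 * ((σ : ℝ) ^ 2 / (σ * A) * (B⁻¹ * (D⁻¹ * N⁻¹))) =
      2 * σ / (A * B) * (D⁻¹ * N⁻¹) := by
    field_simp
  rw [e3, e2]
  field_simp

/-- With high probability, white Gaussian noise correlates weakly with all unit atoms. -/
lemma exists_event_abs_dotProduct_le {Ω : Type*} [MeasurableSpace Ω] (P : Measure Ω)
    [IsProbabilityMeasure P] {m n : ℕ} (hn : 2 ≤ n) {M : Matrix (Fin m) (Fin n) ℝ}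
    (hunit : ∀ j, l2norm (M.col j) = 1) {σ : ℝ≥0} {w : Fin m → Ω → ℝ} (hw : iIndepFun w P)
    (hlaw : ∀ i, HasLaw (w i) (gaussianReal 0 (σ ^ 2)) P) {a : ℝ} (ha : 0 ≤ a) :
    ∃ E : Set Ω, MeasurableSet E ∧
      1 - (√(Real.pi * (1 + a) * Real.log n) * (n : ℝ) ^ a)⁻¹ < P.real E ∧
      ∀ ω ∈ E, ∀ j, |M.col j ⬝ᵥ fun i => w i ω| ≤ σ * √(2 * (1 + a) * Real.log n) := by
  set t := σ * √(2 * (1 + a) * Real.log n) with ht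
  have hn1 : 1 < (n : ℝ) := by exact_mod_cast hn
  have hn0 : 0 < (n : ℝ) := by linarith
  have hL : 0 < Real.log n := Real.log_pos hn1
  have hbound : 0 < (√(Real.pi * (1 + a) * Real.log n) * (n : ℝ) ^ a)⁻¹ := by
    have : 0 < Real.pi * (1 + a) * Real.log n := by
      have := Real.pi_pos
      positivity
    positivity
  have hX : ∀ j, HasLaw (fun ω => M.col j ⬝ᵥ fun i => w i ω) (gaussianReal 0 (σ ^ 2)) P := by
    intro j
    have h := hasLaw_sum_mul_gaussian hw hlaw (M.col j) Finset.univ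
    have h1 : (∑ i, .mk (M.col j i ^ 2) (sq_nonneg _) : ℝ≥0) = 1 := by
      have h2 := l2norm_sq (M.col j)
      rw [hunit, dotProduct] at h2
      ext
      push_cast
      simp only [sq]
      linarith
    rwa [h1, one_mul] at h
  have hmeas : MeasurableSet {x : ℝ | t < |x|} := measurableSet_lt measurable_const (by fun_prop)
  have htail : ∀ j, P.real {ω | t < |M.col j ⬝ᵥ fun i => w i ω|} <
      (√(Real.pi * (1 + a) * Real.log n) * (n : ℝ) ^ a)⁻¹ / n := by
    intro j
    rw [(hX j).measureReal_eq hmeas]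
    -- Without noise the law is a point mass at 0 and the threshold is 0; the tail event, being
    -- strict, is null.
    rcases eq_or_ne σ 0 with rfl | hσ
    · have : (gaussianReal 0 ((0 : ℝ≥0) ^ 2)).real {x : ℝ | t < |x|} = 0 := by
        rw [zero_pow two_ne_zero, gaussianReal_zero_var, measureReal_def,
          Measure.dirac_apply' _ hmeas]
        simp [ht]
      rw [this]
      positivity
    · rw [← mills_value hσ hn1 ha]
      have hσ' : 0 < (σ : ℝ) := by exact_mod_cast pos_iff_ne_zero.2 hσ
      exact gaussianReal_abs_gt_lt (pow_ne_zero 2 hσ)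
        (mul_pos hσ' (Real.sqrt_pos.2 (by positivity)))
  set B : Set Ω := ⋃ j, {ω | t < |M.col j ⬝ᵥ fun i => w i ω|} with hB
  have hPB : P.real B < (√(Real.pi * (1 + a) * Real.log n) * (n : ℝ) ^ a)⁻¹ := by
    have : Nonempty (Fin n) := ⟨⟨0, by omega⟩⟩
    calc P.real B ≤ ∑ j, P.real {ω | t < |M.col j ⬝ᵥ fun i => w i ω|} :=
          measureReal_iUnion_fintype_le _
      _ < ∑ _j : Fin n, (√(Real.pi * (1 + a) * Real.log n) * (n : ℝ) ^ a)⁻¹ / n :=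
          Finset.sum_lt_sum_of_nonempty Finset.univ_nonempty fun j _ => htail j
      _ = _ := by
          rw [Finset.sum_const, Finset.card_univ, Fintype.card_fin, nsmul_eq_mul,
            mul_div_cancel₀ _ hn0.ne']
  -- The noise is only almost everywhere measurable, so the bad event is replaced by a measurable
  -- superset of equal probability.
  refine ⟨(toMeasurable P B)ᶜ, (measurableSet_toMeasurable P B).compl, ?_, fun ω hω j => ?_⟩
  · rw [probReal_compl_eq_one_sub (measurableSet_toMeasurable P B), measureReal_def,
      measure_toMeasurable, ← measureReal_def]
    linarith
  · by_contra! h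
    exact hω (subset_toMeasurable P B (Set.mem_iUnion.2 ⟨j, h⟩))

end Noise

end LeastResidual

end

theorem mainTheorem5 {Ω : Type*} [MeasurableSpace Ω] (P : Measure Ω) [IsProbabilityMeasure P]
    (m n k : ℕ) (hk : 1 ≤ k) (hkn : k < n)
    (M : Matrix (Fin m) (Fin n) ℝ) (hunit : ∀ j, LeastResidual.l2norm (M.col j) = 1)
    (δ : ℝ) (hδ : δ < 1) (hδpos : 0 < (1 - δ) * (1 - δ ^ 2) - δ)
    (hRIP : LeastResidual.RIP M (2 * k) δ)
    (x : Fin n → ℝ) (hx : hammingNorm x = k)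
    (σ : ℝ≥0) (w : Fin m → Ω → ℝ) (hw : iIndepFun w P)
    (hlaw : ∀ i, HasLaw (w i) (gaussianReal 0 (σ ^ 2)) P)
    (a : ℝ) (ha : 0 ≤ a) :
    (∀ y : Fin m → ℝ, LeastResidual.OLSRHalts M y k ∧ LeastResidual.IOLSRHalts M y k) ∧
    ∃ E : Set Ω, MeasurableSet E ∧
      1 - (√(Real.pi * (1 + a) * Real.log n) * (n : ℝ) ^ a)⁻¹ < P.real E ∧
      ∀ ω ∈ E, ∀ y : Fin m → ℝ, y = M *ᵥ x + (fun i => w i ω) →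
        ∀ T : Finset (Fin n),
          LeastResidual.OLSRReturns M y k T ∨ LeastResidual.IOLSRReturns M y k T →
          LeastResidual.l2norm (x - LeastResidual.estimate M y T) ≤
            LeastResidual.c₂ δ *
              √(2 * (k : ℝ) * (σ : ℝ) ^ 2 * (1 + a) * Real.log n) := by

  have hδ0 : 0 ≤ δ := hRIP.nonneg (by omega) hunit ⟨0, by omega⟩
  -- Order `2k` covers supports of size `k + 1` because `k ≥ 1`.
  have hind : ∀ T : Finset (Fin n), T.card ≤ k + 1 → LeastResidual.Indep M T := fun T hT =>
    hRIP.indep hδ (by omega)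
  refine ⟨fun y => ⟨LeastResidual.olsrHalts hind hunit hkn,
    LeastResidual.iolsrHalts hind hunit hkn⟩, ?_⟩
  obtain ⟨E, hE, hPE, hEw⟩ :=
    LeastResidual.exists_event_abs_dotProduct_le P (by omega) hunit hw hlaw ha
  refine ⟨E, hE, hPE, fun ω hω y hy T hT => ?_⟩
  have hout : LeastResidual.IsOutput M y k T :=
    hT.elim (fun h => h.isOutput hind hunit) fun h => h.isOutput hind hunit
  refine (hout.error_le hRIP hδ0 hδ hk hδpos hunit hx (by positivity) (hEw ω hω) hy).trans_eq ?_
  rw [show 2 * (k : ℝ) * (σ : ℝ) ^ 2 * (1 + a) * Real.log n =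
      k * ((σ : ℝ) ^ 2 * (2 * (1 + a) * Real.log n)) by ring,
    Real.sqrt_mul (Nat.cast_nonneg k), Real.sqrt_mul (sq_nonneg _), Real.sqrt_sq σ.coe_nonneg]
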